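/- Let $\{|j\rangle\}_{j\in\mathbb Z_4}$ be the computational basis of $\mathbb C^4$, $X|j\rangle=|j+1 \bmod 4\rangle$, $Z|j\rangle=i^{j}|j\rangle$. The generalized Pauli matrices (GPMs) are $X^mZ^n$, $(m,n)\in\mathbb Z_4^2$; the generalized Bell states (GBSs) are $|\Phi_{m,n}\rangle=(I\otimes X^mZ^n)|\Phi\rangle$, where $|\Phi\rangle=\frac12\sum_{j}|jj\rangle$. A set of four GPMs (a 4-GPM set), or the corresponding set of four GBSs (a 4-GBS set), is identified with its set of labels $(m,n)$; it is called standard if it contains $I$, that is, the label $(0,0)$. Write $\approx$ for equality up to a phase factor. Two $n$-element sets of states $\{\phi_i\}$, $\{\psi_i\}$ in $\mathbb C^4\otimes\mathbb C^4$ are LU-equivalent if $\psi_i\approx(U_A\otimes U_B)\phi_{\sigma(i)}$ for all $i$, for some unitaries $U_A,U_B$ and some permutation $\sigma$. Two $n$-element sets of unitary matrices $\{M_i\}$, $\{N_i\}$ are U-equivalent if $N_i\approx LM_{\sigma(i)}R$ for all $i$, for some unitaries $L,R$ and some permutation $\sigma$; they are UC-equivalent if this holds with $R=L^\dagger$. Consider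 the ten standard 4-GPM sets \begin{align*} \mathcal K&=\{I,X^2,Z^2,X^2Z^2\},&\mathcal L&=\{I,X,X^2,X^3\},&\Gamma^1_{20}&=\{I,X,Z,X^2\},&\Gamma^1_{31}&=\{I,X,Z,X^3Z\},\\ \Gamma^1_{33}&=\{I,X,Z,X^3Z^3\},&\Gamma^2_{12}&=\{I,X,Z^2,XZ^2\},&\Gamma^2_{30}&=\{I,X,Z^2,X^3\},&\Gamma^1_{12}&=\{I,X,Z,XZ^2\},\\ \Gamma^2_{20}&=\{I,X,Z^2,X^2\},&\Gamma^2_{32}&=\{I,X,Z^2,X^3Z^2\}. \end{align*} For $\mathcal M=\{M_0,M_1,M_2,M_3\}$ among these, with elements in the order written, let $\mathcal M_i=\{M_jM_i^\dagger : 0\le j\le 3\}$, let $\mathcal{UC}(\mathcal M_i)$ be the set of all GPM sets UC-equivalent to $\mathcal M_i$, and let $\mathcal U(\mathcal M)$ be the set of all standard GPM sets U-equivalent to $\mathcal M$. Then: 1. The classes $\mathcal{UC}(\mathcal M_i)$ are exactly those in the following list, where $ab.ce.fg$ stands for the set with labels $\{(0,0),(a,b),(c,e),(f,g)\}$; within each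 item the sets are distinct, and their number is given. - $\mathcal{UC}((\mathcal K)_0)=\mathcal{UC}((\mathcal K)_1)=\mathcal{UC}((\mathcal K)_2)=\mathcal{UC}((\mathcal K)_3)$ (1 set): 02.20.22. - $\mathcal{UC}((\mathcal L)_0)=\mathcal{UC}((\mathcal L)_1)=\mathcal{UC}((\mathcal L)_2)=\mathcal{UC}((\mathcal L)_3)$ (6 sets): 01.02.03, 02.21.23, 10.20.30, 11.22.33, 12.20.32, 13.22.31. - $\mathcal{UC}((\Gamma^{1}_{20})_0)$ (48 sets): 01.02.30, 01.02.31, 01.02.32, 01.02.33, 01.10.20, 01.11.22, 01.12.20, 01.13.22, 02.03.10, 02.03.11, 02.03.12, 02.03.13, 02.10.23, 02.11.21, 02.12.23, 02.13.21, 02.21.30, 02.21.32, 02.23.31, 02.23.33, 03.20.30, 03.20.32, 03.22.31, 03.22.33, 10.11.20, 10.13.22, 10.20.21, 10.20.31, 10.22.33, 11.12.22, 11.20.32, 11.22.23, 11.22.30, 12.13.20, 12.20.21, 12.20.33, 12.22.31, 13.20.30, 13.22.23, 13.22.32, 20.23.30, 20.23.32, 20.30.33, 20.31.32, 21.22.31,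 21.22.33, 22.30.31, 22.32.33. - $\mathcal{UC}((\Gamma^{1}_{20})_1)$ (48 sets): 01.03.10, 01.03.11, 01.03.12, 01.03.13, 01.03.30, 01.03.31, 01.03.32, 01.03.33, 01.10.30, 01.11.33, 01.12.32, 01.13.31, 03.10.30, 03.11.33, 03.12.32, 03.13.31, 10.11.30, 10.11.33, 10.13.30, 10.13.31, 10.21.23, 10.21.30, 10.23.30, 10.30.31, 10.30.33, 11.12.32, 11.12.33, 11.21.23, 11.21.33, 11.23.33, 11.30.33, 11.32.33, 12.13.31, 12.13.32, 12.21.23, 12.21.32, 12.23.32, 12.31.32, 12.32.33, 13.21.23, 13.21.31, 13.23.31, 13.30.31, 13.31.32, 21.23.30, 21.23.31, 21.23.32, 21.23.33. - $\mathcal{UC}((\Gamma^{1}_{20})_2)$ (48 sets): 01.10.23, 01.10.32, 01.11.21, 01.11.31, 01.12.23, 01.12.30, 01.13.21, 01.13.33, 01.21.31, 01.21.33, 01.23.30, 01.23.32, 03.10.21, 03.10.32, 03.11.23, 03.11.31, 03.12.21, 03.12.30, 03.13.23, 03.13.33, 03.21.30, 03.21.32, 03.23.31, 03.23.33, 10.11.12,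 10.11.13, 10.12.13, 10.12.31, 10.12.33, 10.21.32, 10.23.32, 10.31.33, 11.12.13, 11.13.30, 11.13.32, 11.21.31, 11.23.31, 11.30.32, 12.21.30, 12.23.30, 12.31.33, 13.21.33, 13.23.33, 13.30.32, 30.31.32, 30.31.33, 30.32.33, 31.32.33. - $\mathcal{UC}((\Gamma^{1}_{20})_3)$ (48 sets): 01.02.10, 01.02.11, 01.02.12, 01.02.13, 01.20.30, 01.20.32, 01.22.31, 01.22.33, 02.03.30, 02.03.31, 02.03.32, 02.03.33, 02.10.21, 02.11.23, 02.12.21, 02.13.23, 02.21.31, 02.21.33, 02.23.30, 02.23.32, 03.10.20, 03.11.22, 03.12.20, 03.13.22, 10.11.22, 10.13.20, 10.20.23, 10.20.33, 10.22.31, 11.12.20, 11.20.30, 11.21.22, 11.22.32, 12.13.22, 12.20.23, 12.20.31, 12.22.33, 13.20.32, 13.21.22, 13.22.30, 20.21.30, 20.21.32, 20.30.31, 20.32.33, 22.23.31, 22.23.33, 22.30.33, 22.31.32. - $\mathcal{UC}((\Gamma^{1}_{31})_0)=\mathcal{UC}((\Gamma^{1}_{31})_1)=\mathcal{UC}((\Gamma^{1}_{31})_2)=\mathcal{UC}((\Gamma^{1}_{31})_3)$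 (48 sets): 01.10.11, 01.10.13, 01.10.31, 01.11.12, 01.11.30, 01.12.13, 01.12.33, 01.13.32, 01.30.31, 01.30.33, 01.31.32, 01.32.33, 03.10.11, 03.10.13, 03.10.33, 03.11.12, 03.11.32, 03.12.13, 03.12.31, 03.13.30, 03.30.31, 03.30.33, 03.31.32, 03.32.33, 10.11.21, 10.13.23, 10.21.31, 10.21.33, 10.23.31, 10.23.33, 11.12.23, 11.21.30, 11.21.32, 11.23.30, 11.23.32, 12.13.21, 12.21.31, 12.21.33, 12.23.31, 12.23.33, 13.21.30, 13.21.32, 13.23.30, 13.23.32, 21.30.31, 21.32.33, 23.30.33, 23.31.32. - $\mathcal{UC}((\Gamma^{1}_{33})_0)=\mathcal{UC}((\Gamma^{1}_{33})_1)=\mathcal{UC}((\Gamma^{1}_{33})_2)=\mathcal{UC}((\Gamma^{1}_{33})_3)$ (16 sets): 01.10.33, 01.11.32, 01.12.31, 01.13.30, 03.10.31, 03.11.30, 03.12.33, 03.13.32, 10.11.23, 10.13.21, 11.12.21, 12.13.23, 21.30.33, 21.31.32, 23.30.31, 23.32.33. - $\mathcal{UC}((\Gamma^{2}_{12})_0)=\mathcal{UC}((\Gamma^{2}_{12})_1)=\mathcal{UC}((\Gamma^{2}_{12})_2)=\mathcal{UC}((\Gamma^{2}_{12})_3)$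 (12 sets): 01.20.21, 01.22.23, 02.10.12, 02.11.13, 02.30.32, 02.31.33, 03.20.23, 03.21.22, 10.22.32, 11.20.31, 12.22.30, 13.20.33. - $\mathcal{UC}((\Gamma^{2}_{30})_0)=\mathcal{UC}((\Gamma^{2}_{30})_2)$ (12 sets): 01.03.20, 01.03.22, 02.10.30, 02.11.33, 02.12.32, 02.13.31, 10.22.30, 11.20.33, 12.22.32, 13.20.31, 20.21.23, 21.22.23. - $\mathcal{UC}((\Gamma^{2}_{30})_1)=\mathcal{UC}((\Gamma^{2}_{30})_3)$ (12 sets): 01.02.21, 01.02.23, 02.03.21, 02.03.23, 10.12.20, 10.20.32, 11.13.22, 11.22.31, 12.20.30, 13.22.33, 20.30.32, 22.31.33. - $\mathcal{UC}((\Gamma^{1}_{12})_0)$ (24 sets): 01.10.12, 01.11.13, 01.21.30, 01.21.32, 01.23.31, 01.23.33, 03.10.23, 03.11.21, 03.12.23, 03.13.21, 03.30.32, 03.31.33, 10.11.32, 10.12.21, 10.13.33, 10.31.32, 11.12.31, 11.13.23, 11.30.31, 12.13.30, 12.30.33, 13.32.33, 21.31.33, 23.30.32. - $\mathcal{UC}((\Gamma^{1}_{12})_1)=\mathcal{UC}((\Gamma^{1}_{12})_3)$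 (48 sets): 01.10.22, 01.11.20, 01.12.22, 01.13.20, 01.20.31, 01.20.33, 01.22.30, 01.22.32, 02.10.11, 02.10.13, 02.10.31, 02.10.33, 02.11.12, 02.11.30, 02.11.32, 02.12.13, 02.12.31, 02.12.33, 02.13.30, 02.13.32, 02.30.31, 02.30.33, 02.31.32, 02.32.33, 03.10.22, 03.11.20, 03.12.22, 03.13.20, 03.20.31, 03.20.33, 03.22.30, 03.22.32, 10.21.22, 10.22.23, 11.20.21, 11.20.23, 12.21.22, 12.22.23, 13.20.21, 13.20.23, 20.21.31, 20.21.33, 20.23.31, 20.23.33, 21.22.30, 21.22.32, 22.23.30, 22.23.32. - $\mathcal{UC}((\Gamma^{1}_{12})_2)$ (24 sets): 01.10.21, 01.11.23, 01.12.21, 01.13.23, 01.30.32, 01.31.33, 03.10.12, 03.11.13, 03.21.31, 03.21.33, 03.23.30, 03.23.32, 10.11.31, 10.12.23, 10.13.32, 10.32.33, 11.12.30, 11.13.21, 11.31.32, 12.13.33, 12.30.31, 13.30.33, 21.30.32, 23.31.33. - $\mathcal{UC}((\Gamma^{2}_{20})_0)=\mathcal{UC}((\Gamma^{2}_{20})_3)$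 (24 sets): 01.02.20, 01.02.22, 02.03.20, 02.03.22, 02.10.20, 02.11.22, 02.12.20, 02.13.22, 02.20.21, 02.20.23, 02.20.30, 02.20.32, 02.21.22, 02.22.23, 02.22.31, 02.22.33, 10.20.22, 11.20.22, 12.20.22, 13.20.22, 20.22.30, 20.22.31, 20.22.32, 20.22.33. - $\mathcal{UC}((\Gamma^{2}_{20})_1)$ (12 sets): 01.03.21, 01.03.23, 01.21.23, 03.21.23, 10.12.30, 10.12.32, 10.30.32, 11.13.31, 11.13.33, 11.31.33, 12.30.32, 13.31.33. - $\mathcal{UC}((\Gamma^{2}_{20})_2)$ (12 sets): 01.20.22, 02.10.22, 02.11.20, 02.12.22, 02.13.20, 02.20.31, 02.20.33, 02.22.30, 02.22.32, 03.20.22, 20.21.22, 20.22.23. - $\mathcal{UC}((\Gamma^{2}_{32})_0)=\mathcal{UC}((\Gamma^{2}_{32})_1)=\mathcal{UC}((\Gamma^{2}_{32})_2)=\mathcal{UC}((\Gamma^{2}_{32})_3)$ (12 sets): 01.20.23, 01.21.22, 02.10.32, 02.11.31, 02.12.30, 02.13.33, 03.20.21, 03.22.23, 10.12.22, 11.13.20,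 20.31.33, 22.30.32. 2. For each of the ten sets, $\mathcal U(\mathcal M)=\bigcup_{i=0}^{3}\mathcal{UC}(\mathcal M_i)$, so that $\mathcal U(\mathcal M)$ is the union of the items listed for $\mathcal M$. The numbers of elements of $\mathcal U(\mathcal K)$, $\mathcal U(\mathcal L)$, $\mathcal U(\Gamma^1_{20})$, $\mathcal U(\Gamma^1_{31})$, $\mathcal U(\Gamma^1_{33})$, $\mathcal U(\Gamma^2_{12})$, $\mathcal U(\Gamma^2_{30})$, $\mathcal U(\Gamma^1_{12})$, $\mathcal U(\Gamma^2_{20})$, $\mathcal U(\Gamma^2_{32})$ are $1$, $6$, $192$, $48$, $16$, $12$, $24$, $96$, $48$, $12$. 3. The ten GPM sets are pairwise not U-equivalent, and the ten corresponding GBS sets are pairwise not LU-equivalent. 4. Every 4-GBS set in $\mathbb C^4\otimes\mathbb C^4$ (standard or not) is LU-equivalent to exactly one of the ten GBS sets. -/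

import Mathlib

open scoped Matrix Kronecker

namespace GBS

noncomputable section

/-- Equality up to a global phase. -/
def PhaseEq {V : Type*} [SMul ℂ V] (a b : V) : Prop :=
  ∃ c : ℂ, ‖c‖ = 1 ∧ a = c • b

/-- `d × d` complex matrices, with rows and columns indexed by the computational basis
`|j⟩`, `j ∈ ℤ/d`. -/
abbrev Mat (d : ℕ) : Type := Matrix (ZMod d) (ZMod d) ℂ

/-- Vectors of `ℂ^d ⊗ ℂ^d` in coordinates with respect to the basis `|j⟩ ⊗ |k⟩`. -/
abbrev BiVec (d : ℕ) : Type := ZMod d × ZMod d → ℂ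

section Dim

variable (d : ℕ) [NeZero d]

/-- The shift `X |j⟩ = |j + 1 mod d⟩`. -/
def shiftX : Mat d := Matrix.of fun i j => if i = j + 1 then 1 else 0

/-- The clock `Z |j⟩ = ω ^ j |j⟩`, where `ω = exp (2 π i / d)`. -/
def clockZ : Mat d :=
  Matrix.diagonal fun j => Complex.exp (2 * Real.pi * Complex.I / d) ^ j.val

variable {d}

/-- The generalized Pauli matrix `X ^ m Z ^ n` with label `(m, n)`. -/
def gpm (p : ZMod d × ZMod d) : Mat d := shiftX d ^ p.1.val * clockZ d ^ p.2.val

variable (d) in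
/-- The canonical maximally entangled state `(1 / √d) ∑ j, |j⟩ ⊗ |j⟩`. -/
def maxEnt : BiVec d := fun x => if x.1 = x.2 then (1 / Real.sqrt d : ℂ) else 0

/-- The maximally entangled state `(I ⊗ U) |Φ⟩` of a unitary matrix `U`. -/
def mes (U : Mat d) : BiVec d := ((1 : Mat d) ⊗ₖ U) *ᵥ maxEnt d

/-- The generalized Bell state `(I ⊗ X ^ m Z ^ n) |Φ⟩`. -/
def gbs (p : ZMod d × ZMod d) : BiVec d := mes (gpm p)

/-- Local unitary equivalence of two sets of bipartite states, each given as a family of its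
members: `ψ i ≈ (U_A ⊗ U_B) φ (σ i)` for unitaries `U_A`, `U_B` and a bijection `σ`. -/
def LUEquiv {ι κ : Type*} (φ : ι → BiVec d) (ψ : κ → BiVec d) : Prop :=
  ∃ UA ∈ Matrix.unitaryGroup (ZMod d) ℂ, ∃ UB ∈ Matrix.unitaryGroup (ZMod d) ℂ,
    ∃ σ : κ ≃ ι, ∀ i, PhaseEq (ψ i) ((UA ⊗ₖ UB) *ᵥ φ (σ i))

/-- U-equivalence `L M R ≈ N` of two sets of matrices, each given as a family of its members. -/
def UEquiv {ι κ : Type*} (M : ι → Mat d) (N : κ → Mat d) : Prop :=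
  ∃ L ∈ Matrix.unitaryGroup (ZMod d) ℂ, ∃ R ∈ Matrix.unitaryGroup (ZMod d) ℂ,
    ∃ σ : κ ≃ ι, ∀ i, PhaseEq (N i) (L * M (σ i) * R)

/-- Unitary conjugate equivalence: U-equivalence with `R = L†`. -/
def UCEquiv {ι κ : Type*} (M : ι → Mat d) (N : κ → Mat d) : Prop :=
  ∃ L ∈ Matrix.unitaryGroup (ZMod d) ℂ,
    ∃ σ : κ ≃ ι, ∀ i, PhaseEq (N i) (L * M (σ i) * Lᴴ)

/-- The set of generalized Pauli matrices with labels in `S`, as a family of its members. -/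
def gpmSet (S : Finset (ZMod d × ZMod d)) : S → Mat d := fun p => gpm p.1

/-- The set of generalized Bell states with labels in `S`, as a family of its members. -/
def gbsSet (S : Finset (ZMod d × ZMod d)) : S → BiVec d := fun p => gbs p.1

/-- All GPM sets, given by their sets of labels, that are UC-equivalent to `M`. -/
def UCClass {ι : Type*} (M : ι → Mat d) : Set (Finset (ZMod d × ZMod d)) :=
  {N | UCEquiv M (gpmSet N)}

/-- All standard GPM sets (those that contain the identity, whose label is `(0, 0)`) that are
U-equivalent to `M`. -/
def UClass {ι : Type*} (M : ι → Mat d) : Set (Finset (ZMod d × ZMod d)) :=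
  {N | (0, 0) ∈ N ∧ UEquiv M (gpmSet N)}

/-- The set `M Mᵢ†`. -/
def rightDiv {ι : Type*} (M : ι → Mat d) (i : ι) : ι → Mat d := fun j => M j * (M i)ᴴ

end Dim

end

/-- Labels `(m, n)` of the generalized Pauli matrices on `ℂ^4`. -/
abbrev Label : Type := ZMod 4 × ZMod 4

/-- The labels of the ten representatives
`K`, `L`, `Γ¹₂₀`, `Γ¹₃₁`, `Γ¹₃₃`, `Γ²₁₂`, `Γ²₃₀`, `Γ¹₁₂`, `Γ²₂₀`, `Γ²₃₂`, in this order. -/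
def rep : Fin 10 → Fin 4 → Label :=
  ![![(0, 0), (2, 0), (0, 2), (2, 2)],
    ![(0, 0), (1, 0), (2, 0), (3, 0)],
    ![(0, 0), (1, 0), (0, 1), (2, 0)],
    ![(0, 0), (1, 0), (0, 1), (3, 1)],
    ![(0, 0), (1, 0), (0, 1), (3, 3)],
    ![(0, 0), (1, 0), (0, 2), (1, 2)],
    ![(0, 0), (1, 0), (0, 2), (3, 0)],
    ![(0, 0), (1, 0), (0, 1), (1, 2)],
    ![(0, 0), (1, 0), (0, 2), (2, 0)],
    ![(0, 0), (1, 0), (0, 2), (3, 2)]]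

/-- The representative GPM set with number `k`. -/
noncomputable def repGPM (k : Fin 10) : Fin 4 → Mat 4 := fun j => gpm (rep k j)

/-- The representative GBS set with number `k`. -/
noncomputable def repGBS (k : Fin 10) : Fin 4 → BiVec 4 := fun j => gbs (rep k j)

/-- The standard label set `{(0, 0), (a, b), (c, e), (f, g)}`. -/
def st (a b c e f g : ZMod 4) : Finset Label := {(0, 0), (a, b), (c, e), (f, g)}

/-- The listed class of the set `M M₀†` for `M = K` (1 items). -/
def ucK_0 : List (Finset Label) :=
  [st 0 2 2 0 2 2]

/-- The listed class of the set `M M₀†` for `M = L` (6 items). -/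
def ucL_0 : List (Finset Label) :=
  [st 0 1 0 2 0 3, st 0 2 2 1 2 3, st 1 0 2 0 3 0, st 1 1 2 2 3 3, st 1 2 2 0 3 2,
   st 1 3 2 2 3 1]

/-- The listed class of the set `M M₀†` for `M = Γ¹₂₀` (48 items). -/
def ucG120_0 : List (Finset Label) :=
  [st 0 1 0 2 3 0, st 0 1 0 2 3 1, st 0 1 0 2 3 2, st 0 1 0 2 3 3, st 0 1 1 0 2 0,
   st 0 1 1 1 2 2, st 0 1 1 2 2 0, st 0 1 1 3 2 2, st 0 2 0 3 1 0, st 0 2 0 3 1 1,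
   st 0 2 0 3 1 2, st 0 2 0 3 1 3, st 0 2 1 0 2 3, st 0 2 1 1 2 1, st 0 2 1 2 2 3,
   st 0 2 1 3 2 1, st 0 2 2 1 3 0, st 0 2 2 1 3 2, st 0 2 2 3 3 1, st 0 2 2 3 3 3,
   st 0 3 2 0 3 0, st 0 3 2 0 3 2, st 0 3 2 2 3 1, st 0 3 2 2 3 3, st 1 0 1 1 2 0,
   st 1 0 1 3 2 2, st 1 0 2 0 2 1, st 1 0 2 0 3 1, st 1 0 2 2 3 3, st 1 1 1 2 2 2,
   st 1 1 2 0 3 2, st 1 1 2 2 2 3, st 1 1 2 2 3 0, st 1 2 1 3 2 0, st 1 2 2 0 2 1,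
   st 1 2 2 0 3 3, st 1 2 2 2 3 1, st 1 3 2 0 3 0, st 1 3 2 2 2 3, st 1 3 2 2 3 2,
   st 2 0 2 3 3 0, st 2 0 2 3 3 2, st 2 0 3 0 3 3, st 2 0 3 1 3 2, st 2 1 2 2 3 1,
   st 2 1 2 2 3 3, st 2 2 3 0 3 1, st 2 2 3 2 3 3]

/-- The listed class of the set `M M₁†` for `M = Γ¹₂₀` (48 items). -/
def ucG120_1 : List (Finset Label) :=
  [st 0 1 0 3 1 0, st 0 1 0 3 1 1, st 0 1 0 3 1 2, st 0 1 0 3 1 3, st 0 1 0 3 3 0,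
   st 0 1 0 3 3 1, st 0 1 0 3 3 2, st 0 1 0 3 3 3, st 0 1 1 0 3 0, st 0 1 1 1 3 3,
   st 0 1 1 2 3 2, st 0 1 1 3 3 1, st 0 3 1 0 3 0, st 0 3 1 1 3 3, st 0 3 1 2 3 2,
   st 0 3 1 3 3 1, st 1 0 1 1 3 0, st 1 0 1 1 3 3, st 1 0 1 3 3 0, st 1 0 1 3 3 1,
   st 1 0 2 1 2 3, st 1 0 2 1 3 0, st 1 0 2 3 3 0, st 1 0 3 0 3 1, st 1 0 3 0 3 3,
   st 1 1 1 2 3 2, st 1 1 1 2 3 3, st 1 1 2 1 2 3, st 1 1 2 1 3 3, st 1 1 2 3 3 3,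
   st 1 1 3 0 3 3, st 1 1 3 2 3 3, st 1 2 1 3 3 1, st 1 2 1 3 3 2, st 1 2 2 1 2 3,
   st 1 2 2 1 3 2, st 1 2 2 3 3 2, st 1 2 3 1 3 2, st 1 2 3 2 3 3, st 1 3 2 1 2 3,
   st 1 3 2 1 3 1, st 1 3 2 3 3 1, st 1 3 3 0 3 1, st 1 3 3 1 3 2, st 2 1 2 3 3 0,
   st 2 1 2 3 3 1, st 2 1 2 3 3 2, st 2 1 2 3 3 3]

/-- The listed class of the set `M M₂†` for `M = Γ¹₂₀` (48 items). -/
def ucG120_2 : List (Finset Label) :=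
  [st 0 1 1 0 2 3, st 0 1 1 0 3 2, st 0 1 1 1 2 1, st 0 1 1 1 3 1, st 0 1 1 2 2 3,
   st 0 1 1 2 3 0, st 0 1 1 3 2 1, st 0 1 1 3 3 3, st 0 1 2 1 3 1, st 0 1 2 1 3 3,
   st 0 1 2 3 3 0, st 0 1 2 3 3 2, st 0 3 1 0 2 1, st 0 3 1 0 3 2, st 0 3 1 1 2 3,
   st 0 3 1 1 3 1, st 0 3 1 2 2 1, st 0 3 1 2 3 0, st 0 3 1 3 2 3, st 0 3 1 3 3 3,
   st 0 3 2 1 3 0, st 0 3 2 1 3 2, st 0 3 2 3 3 1, st 0 3 2 3 3 3, st 1 0 1 1 1 2,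
   st 1 0 1 1 1 3, st 1 0 1 2 1 3, st 1 0 1 2 3 1, st 1 0 1 2 3 3, st 1 0 2 1 3 2,
   st 1 0 2 3 3 2, st 1 0 3 1 3 3, st 1 1 1 2 1 3, st 1 1 1 3 3 0, st 1 1 1 3 3 2,
   st 1 1 2 1 3 1, st 1 1 2 3 3 1, st 1 1 3 0 3 2, st 1 2 2 1 3 0, st 1 2 2 3 3 0,
   st 1 2 3 1 3 3, st 1 3 2 1 3 3, st 1 3 2 3 3 3, st 1 3 3 0 3 2, st 3 0 3 1 3 2,
   st 3 0 3 1 3 3, st 3 0 3 2 3 3, st 3 1 3 2 3 3]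

/-- The listed class of the set `M M₃†` for `M = Γ¹₂₀` (48 items). -/
def ucG120_3 : List (Finset Label) :=
  [st 0 1 0 2 1 0, st 0 1 0 2 1 1, st 0 1 0 2 1 2, st 0 1 0 2 1 3, st 0 1 2 0 3 0,
   st 0 1 2 0 3 2, st 0 1 2 2 3 1, st 0 1 2 2 3 3, st 0 2 0 3 3 0, st 0 2 0 3 3 1,
   st 0 2 0 3 3 2, st 0 2 0 3 3 3, st 0 2 1 0 2 1, st 0 2 1 1 2 3, st 0 2 1 2 2 1,
   st 0 2 1 3 2 3, st 0 2 2 1 3 1, st 0 2 2 1 3 3, st 0 2 2 3 3 0, st 0 2 2 3 3 2,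
   st 0 3 1 0 2 0, st 0 3 1 1 2 2, st 0 3 1 2 2 0, st 0 3 1 3 2 2, st 1 0 1 1 2 2,
   st 1 0 1 3 2 0, st 1 0 2 0 2 3, st 1 0 2 0 3 3, st 1 0 2 2 3 1, st 1 1 1 2 2 0,
   st 1 1 2 0 3 0, st 1 1 2 1 2 2, st 1 1 2 2 3 2, st 1 2 1 3 2 2, st 1 2 2 0 2 3,
   st 1 2 2 0 3 1, st 1 2 2 2 3 3, st 1 3 2 0 3 2, st 1 3 2 1 2 2, st 1 3 2 2 3 0,
   st 2 0 2 1 3 0, st 2 0 2 1 3 2, st 2 0 3 0 3 1, st 2 0 3 2 3 3, st 2 2 2 3 3 1,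
   st 2 2 2 3 3 3, st 2 2 3 0 3 3, st 2 2 3 1 3 2]

/-- The listed class of the set `M M₀†` for `M = Γ¹₃₁` (48 items). -/
def ucG131_0 : List (Finset Label) :=
  [st 0 1 1 0 1 1, st 0 1 1 0 1 3, st 0 1 1 0 3 1, st 0 1 1 1 1 2, st 0 1 1 1 3 0,
   st 0 1 1 2 1 3, st 0 1 1 2 3 3, st 0 1 1 3 3 2, st 0 1 3 0 3 1, st 0 1 3 0 3 3,
   st 0 1 3 1 3 2, st 0 1 3 2 3 3, st 0 3 1 0 1 1, st 0 3 1 0 1 3, st 0 3 1 0 3 3,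
   st 0 3 1 1 1 2, st 0 3 1 1 3 2, st 0 3 1 2 1 3, st 0 3 1 2 3 1, st 0 3 1 3 3 0,
   st 0 3 3 0 3 1, st 0 3 3 0 3 3, st 0 3 3 1 3 2, st 0 3 3 2 3 3, st 1 0 1 1 2 1,
   st 1 0 1 3 2 3, st 1 0 2 1 3 1, st 1 0 2 1 3 3, st 1 0 2 3 3 1, st 1 0 2 3 3 3,
   st 1 1 1 2 2 3, st 1 1 2 1 3 0, st 1 1 2 1 3 2, st 1 1 2 3 3 0, st 1 1 2 3 3 2,
   st 1 2 1 3 2 1, st 1 2 2 1 3 1, st 1 2 2 1 3 3, st 1 2 2 3 3 1, st 1 2 2 3 3 3,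
   st 1 3 2 1 3 0, st 1 3 2 1 3 2, st 1 3 2 3 3 0, st 1 3 2 3 3 2, st 2 1 3 0 3 1,
   st 2 1 3 2 3 3, st 2 3 3 0 3 3, st 2 3 3 1 3 2]

/-- The listed class of the set `M M₀†` for `M = Γ¹₃₃` (16 items). -/
def ucG133_0 : List (Finset Label) :=
  [st 0 1 1 0 3 3, st 0 1 1 1 3 2, st 0 1 1 2 3 1, st 0 1 1 3 3 0, st 0 3 1 0 3 1,
   st 0 3 1 1 3 0, st 0 3 1 2 3 3, st 0 3 1 3 3 2, st 1 0 1 1 2 3, st 1 0 1 3 2 1,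
   st 1 1 1 2 2 1, st 1 2 1 3 2 3, st 2 1 3 0 3 3, st 2 1 3 1 3 2, st 2 3 3 0 3 1,
   st 2 3 3 2 3 3]

/-- The listed class of the set `M M₀†` for `M = Γ²₁₂` (12 items). -/
def ucG212_0 : List (Finset Label) :=
  [st 0 1 2 0 2 1, st 0 1 2 2 2 3, st 0 2 1 0 1 2, st 0 2 1 1 1 3, st 0 2 3 0 3 2,
   st 0 2 3 1 3 3, st 0 3 2 0 2 3, st 0 3 2 1 2 2, st 1 0 2 2 3 2, st 1 1 2 0 3 1,
   st 1 2 2 2 3 0, st 1 3 2 0 3 3]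

/-- The listed class of the set `M M₀†` for `M = Γ²₃₀` (12 items). -/
def ucG230_0 : List (Finset Label) :=
  [st 0 1 0 3 2 0, st 0 1 0 3 2 2, st 0 2 1 0 3 0, st 0 2 1 1 3 3, st 0 2 1 2 3 2,
   st 0 2 1 3 3 1, st 1 0 2 2 3 0, st 1 1 2 0 3 3, st 1 2 2 2 3 2, st 1 3 2 0 3 1,
   st 2 0 2 1 2 3, st 2 1 2 2 2 3]

/-- The listed class of the set `M M₁†` for `M = Γ²₃₀` (12 items). -/
def ucG230_1 : List (Finset Label) :=
  [st 0 1 0 2 2 1, st 0 1 0 2 2 3, st 0 2 0 3 2 1, st 0 2 0 3 2 3, st 1 0 1 2 2 0,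
   st 1 0 2 0 3 2, st 1 1 1 3 2 2, st 1 1 2 2 3 1, st 1 2 2 0 3 0, st 1 3 2 2 3 3,
   st 2 0 3 0 3 2, st 2 2 3 1 3 3]

/-- The listed class of the set `M M₀†` for `M = Γ¹₁₂` (24 items). -/
def ucG112_0 : List (Finset Label) :=
  [st 0 1 1 0 1 2, st 0 1 1 1 1 3, st 0 1 2 1 3 0, st 0 1 2 1 3 2, st 0 1 2 3 3 1,
   st 0 1 2 3 3 3, st 0 3 1 0 2 3, st 0 3 1 1 2 1, st 0 3 1 2 2 3, st 0 3 1 3 2 1,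
   st 0 3 3 0 3 2, st 0 3 3 1 3 3, st 1 0 1 1 3 2, st 1 0 1 2 2 1, st 1 0 1 3 3 3,
   st 1 0 3 1 3 2, st 1 1 1 2 3 1, st 1 1 1 3 2 3, st 1 1 3 0 3 1, st 1 2 1 3 3 0,
   st 1 2 3 0 3 3, st 1 3 3 2 3 3, st 2 1 3 1 3 3, st 2 3 3 0 3 2]

/-- The listed class of the set `M M₁†` for `M = Γ¹₁₂` (48 items). -/
def ucG112_1 : List (Finset Label) :=
  [st 0 1 1 0 2 2, st 0 1 1 1 2 0, st 0 1 1 2 2 2, st 0 1 1 3 2 0, st 0 1 2 0 3 1,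
   st 0 1 2 0 3 3, st 0 1 2 2 3 0, st 0 1 2 2 3 2, st 0 2 1 0 1 1, st 0 2 1 0 1 3,
   st 0 2 1 0 3 1, st 0 2 1 0 3 3, st 0 2 1 1 1 2, st 0 2 1 1 3 0, st 0 2 1 1 3 2,
   st 0 2 1 2 1 3, st 0 2 1 2 3 1, st 0 2 1 2 3 3, st 0 2 1 3 3 0, st 0 2 1 3 3 2,
   st 0 2 3 0 3 1, st 0 2 3 0 3 3, st 0 2 3 1 3 2, st 0 2 3 2 3 3, st 0 3 1 0 2 2,
   st 0 3 1 1 2 0, st 0 3 1 2 2 2, st 0 3 1 3 2 0, st 0 3 2 0 3 1, st 0 3 2 0 3 3,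
   st 0 3 2 2 3 0, st 0 3 2 2 3 2, st 1 0 2 1 2 2, st 1 0 2 2 2 3, st 1 1 2 0 2 1,
   st 1 1 2 0 2 3, st 1 2 2 1 2 2, st 1 2 2 2 2 3, st 1 3 2 0 2 1, st 1 3 2 0 2 3,
   st 2 0 2 1 3 1, st 2 0 2 1 3 3, st 2 0 2 3 3 1, st 2 0 2 3 3 3, st 2 1 2 2 3 0,
   st 2 1 2 2 3 2, st 2 2 2 3 3 0, st 2 2 2 3 3 2]

/-- The listed class of the set `M M₂†` for `M = Γ¹₁₂` (24 items). -/
def ucG112_2 : List (Finset Label) :=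
  [st 0 1 1 0 2 1, st 0 1 1 1 2 3, st 0 1 1 2 2 1, st 0 1 1 3 2 3, st 0 1 3 0 3 2,
   st 0 1 3 1 3 3, st 0 3 1 0 1 2, st 0 3 1 1 1 3, st 0 3 2 1 3 1, st 0 3 2 1 3 3,
   st 0 3 2 3 3 0, st 0 3 2 3 3 2, st 1 0 1 1 3 1, st 1 0 1 2 2 3, st 1 0 1 3 3 2,
   st 1 0 3 2 3 3, st 1 1 1 2 3 0, st 1 1 1 3 2 1, st 1 1 3 1 3 2, st 1 2 1 3 3 3,
   st 1 2 3 0 3 1, st 1 3 3 0 3 3, st 2 1 3 0 3 2, st 2 3 3 1 3 3]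

/-- The listed class of the set `M M₀†` for `M = Γ²₂₀` (24 items). -/
def ucG220_0 : List (Finset Label) :=
  [st 0 1 0 2 2 0, st 0 1 0 2 2 2, st 0 2 0 3 2 0, st 0 2 0 3 2 2, st 0 2 1 0 2 0,
   st 0 2 1 1 2 2, st 0 2 1 2 2 0, st 0 2 1 3 2 2, st 0 2 2 0 2 1, st 0 2 2 0 2 3,
   st 0 2 2 0 3 0, st 0 2 2 0 3 2, st 0 2 2 1 2 2, st 0 2 2 2 2 3, st 0 2 2 2 3 1,
   st 0 2 2 2 3 3, st 1 0 2 0 2 2, st 1 1 2 0 2 2, st 1 2 2 0 2 2, st 1 3 2 0 2 2,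
   st 2 0 2 2 3 0, st 2 0 2 2 3 1, st 2 0 2 2 3 2, st 2 0 2 2 3 3]

/-- The listed class of the set `M M₁†` for `M = Γ²₂₀` (12 items). -/
def ucG220_1 : List (Finset Label) :=
  [st 0 1 0 3 2 1, st 0 1 0 3 2 3, st 0 1 2 1 2 3, st 0 3 2 1 2 3, st 1 0 1 2 3 0,
   st 1 0 1 2 3 2, st 1 0 3 0 3 2, st 1 1 1 3 3 1, st 1 1 1 3 3 3, st 1 1 3 1 3 3,
   st 1 2 3 0 3 2, st 1 3 3 1 3 3]

/-- The listed class of the set `M M₂†` for `M = Γ²₂₀` (12 items). -/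
def ucG220_2 : List (Finset Label) :=
  [st 0 1 2 0 2 2, st 0 2 1 0 2 2, st 0 2 1 1 2 0, st 0 2 1 2 2 2, st 0 2 1 3 2 0,
   st 0 2 2 0 3 1, st 0 2 2 0 3 3, st 0 2 2 2 3 0, st 0 2 2 2 3 2, st 0 3 2 0 2 2,
   st 2 0 2 1 2 2, st 2 0 2 2 2 3]

/-- The listed class of the set `M M₀†` for `M = Γ²₃₂` (12 items). -/
def ucG232_0 : List (Finset Label) :=
  [st 0 1 2 0 2 3, st 0 1 2 1 2 2, st 0 2 1 0 3 2, st 0 2 1 1 3 1, st 0 2 1 2 3 0,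
   st 0 2 1 3 3 3, st 0 3 2 0 2 1, st 0 3 2 2 2 3, st 1 0 1 2 2 2, st 1 1 1 3 2 0,
   st 2 0 3 1 3 3, st 2 2 3 0 3 2]

/-- Row `k`, column `i`: the list of the GPM sets UC-equivalent to `M Mᵢ†`, where `M` is the
representative with number `k`. -/
def ucTable : Fin 10 → Fin 4 → List (Finset Label) :=
  ![![ucK_0, ucK_0, ucK_0, ucK_0],
    ![ucL_0, ucL_0, ucL_0, ucL_0],
    ![ucG120_0, ucG120_1, ucG120_2, ucG120_3],
    ![ucG131_0, ucG131_0, ucG131_0, ucG131_0],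
    ![ucG133_0, ucG133_0, ucG133_0, ucG133_0],
    ![ucG212_0, ucG212_0, ucG212_0, ucG212_0],
    ![ucG230_0, ucG230_1, ucG230_0, ucG230_1],
    ![ucG112_0, ucG112_1, ucG112_2, ucG112_1],
    ![ucG220_0, ucG220_1, ucG220_2, ucG220_0],
    ![ucG232_0, ucG232_0, ucG232_0, ucG232_0]]

/-- Entry `k`: the list of the standard GPM sets U-equivalent to the representative with
number `k`. -/
def uTable : Fin 10 → List (Finset Label) :=
  ![ucK_0,
    ucL_0,
    ucG120_0 ++ ucG120_1 ++ ucG120_2 ++ ucG120_3,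
    ucG131_0,
    ucG133_0,
    ucG212_0,
    ucG230_0 ++ ucG230_1,
    ucG112_0 ++ ucG112_1 ++ ucG112_2,
    ucG220_0 ++ ucG220_1 ++ ucG220_2,
    ucG232_0]

/-- The sizes of the ten U-equivalence classes of standard sets. -/
def classSize : Fin 10 → ℕ := ![1, 6, 192, 48, 16, 12, 24, 96, 48, 12]

/-- Row `k`, column `i`: the size of the UC-equivalence class of `M Mᵢ†`, where `M` is the
representative with number `k`. -/
def ucSize : Fin 10 → Fin 4 → ℕ :=
  ![![1, 1, 1, 1],
    ![6, 6, 6, 6],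
    ![48, 48, 48, 48],
    ![48, 48, 48, 48],
    ![16, 16, 16, 16],
    ![12, 12, 12, 12],
    ![12, 12, 12, 12],
    ![24, 48, 24, 48],
    ![24, 12, 12, 24],
    ![12, 12, 12, 12]]

end GBS

/-!
Under `vec`, the state `(I ⊗ U) |Φ⟩` corresponds to `U` and `A ⊗ B` acts as `U ↦ B U Aᵀ`, so
LU-equivalence of states is U-equivalence of matrices. In a U-equivalence onto a standard set, some
`Mᵢ` is sent to the identity, which forces `R ≈ Mᵢ† L†`; hence the U-class is the union of the
UC-classes of the sets `M Mᵢ†`.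

The discrete Fourier transform and a diagonal matrix of quadratic phases conjugate generalized
Pauli matrices to one another and act on labels as generators of `SL(2, ℤ/d)`. Words in these two
realize all the listed sets. Conversely, conjugation is additive on labels and preserves their
symplectic form, and an invariant built from these two structures distinguishes the listed classes.
Since there are `choose 15 3 = 455` standard sets of four labels, which is the number of listed
sets, the lists are complete.
-/

namespace GBS

open Matrix ZMod

section PhaseEq

variable {V A : Type*}

theorem PhaseEq.refl [MulAction ℂ V] (a : V) : PhaseEq a a :=
  ⟨1, norm_one, (one_smul ℂ a).symm⟩

theorem PhaseEq.symm [MulAction ℂ V] {a b : V} (h : PhaseEq a b) : PhaseEq b a := by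
  obtain ⟨c, hc, rfl⟩ := h
  have hc0 : c ≠ 0 := norm_ne_zero_iff.1 (hc ▸ one_ne_zero)
  exact ⟨c⁻¹, by rw [norm_inv, hc, inv_one], (inv_smul_smul₀ hc0 b).symm⟩

theorem PhaseEq.trans [MulAction ℂ V] {a b c : V} (h : PhaseEq a b) (h' : PhaseEq b c) :
    PhaseEq a c := by
  obtain ⟨x, hx, rfl⟩ := h
  obtain ⟨y, hy, rfl⟩ := h'
  exact ⟨x * y, by rw [norm_mul, hx, hy, one_mul], smul_smul x y c⟩

theorem PhaseEq.mul [Semiring A] [Algebra ℂ A] {a a' b b' : A} (h : PhaseEq a b)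
    (h' : PhaseEq a' b') : PhaseEq (a * a') (b * b') := by
  obtain ⟨x, hx, rfl⟩ := h
  obtain ⟨y, hy, rfl⟩ := h'
  exact ⟨x * y, by rw [norm_mul, hx, hy, one_mul], smul_mul_smul_comm x b y b'⟩

theorem PhaseEq.mul_mul [Semiring A] [Algebra ℂ A] {a b : A} (l r : A) (h : PhaseEq a b) :
    PhaseEq (l * a * r) (l * b * r) :=
  ((PhaseEq.refl l).mul h).mul (PhaseEq.refl r)

end PhaseEq

section Unitary

variable {n : Type*} [Fintype n] [DecidableEq n] {U : Matrix n n ℂ}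

theorem mul_conjTranspose_of_mem (hU : U ∈ unitaryGroup n ℂ) : U * Uᴴ = 1 :=
  mem_unitaryGroup_iff.1 hU

theorem conjTranspose_mul_of_mem (hU : U ∈ unitaryGroup n ℂ) : Uᴴ * U = 1 :=
  mem_unitaryGroup_iff'.1 hU

theorem conjTranspose_mem (hU : U ∈ unitaryGroup n ℂ) : Uᴴ ∈ unitaryGroup n ℂ :=
  Unitary.star_mem hU

theorem diagonal_mem_unitaryGroup {f : n → ℂ} (hf : ∀ j, ‖f j‖ = 1) :
    diagonal f ∈ unitaryGroup n ℂ := by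
  rw [mem_unitaryGroup_iff, star_eq_conjTranspose, diagonal_conjTranspose, diagonal_mul_diagonal,
    ← diagonal_one]
  congr 1
  ext j
  simp [Complex.mul_conj, Complex.normSq_eq_norm_sq, hf]

theorem PhaseEq.conjTranspose_mul_mul {L M N R : Matrix n n ℂ} (hL : L ∈ unitaryGroup n ℂ)
    (hR : R ∈ unitaryGroup n ℂ) (h : PhaseEq N (L * M * R)) : PhaseEq M (Lᴴ * N * Rᴴ) := by
  have hcancel : Lᴴ * (L * M * R) * Rᴴ = M := by
    calc Lᴴ * (L * M * R) * Rᴴ = (Lᴴ * L) * M * (R * Rᴴ) := by simp only [Matrix.mul_assoc]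
      _ = M := by rw [conjTranspose_mul_of_mem hL, mul_conjTranspose_of_mem hR, Matrix.one_mul,
          Matrix.mul_one]
  exact (hcancel ▸ h.mul_mul Lᴴ Rᴴ).symm

end Unitary

section Equivalences

variable {d : ℕ} [NeZero d] {ι κ μ : Type*} {M : ι → Mat d} {N : κ → Mat d} {P : μ → Mat d}

theorem UEquiv.symm (h : UEquiv M N) : UEquiv N M := by
  obtain ⟨L, hL, R, hR, σ, h⟩ := h
  refine ⟨Lᴴ, conjTranspose_mem hL, Rᴴ, conjTranspose_mem hR, σ.symm, fun i => ?_⟩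
  have hi := h (σ.symm i)
  rw [Equiv.apply_symm_apply] at hi
  exact hi.conjTranspose_mul_mul hL hR

theorem UEquiv.trans (h : UEquiv M N) (h' : UEquiv N P) : UEquiv M P := by
  obtain ⟨L, hL, R, hR, σ, h⟩ := h
  obtain ⟨L', hL', R', hR', τ, h'⟩ := h'
  refine ⟨L' * L, mul_mem hL' hL, R * R', mul_mem hR hR', τ.trans σ, fun i => ?_⟩
  simpa only [Equiv.trans_apply, Matrix.mul_assoc] using (h' i).trans ((h (τ i)).mul_mul L' R')

theorem UCEquiv.uEquiv (h : UCEquiv M N) : UEquiv M N := by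
  obtain ⟨L, hL, σ, h⟩ := h
  exact ⟨L, hL, Lᴴ, conjTranspose_mem hL, σ, h⟩

theorem UCEquiv.of_phaseEq (σ : κ ≃ ι) (h : ∀ i, PhaseEq (N i) (M (σ i))) : UCEquiv M N :=
  ⟨1, one_mem _, σ, fun i => by simpa using h i⟩

theorem UCEquiv.symm (h : UCEquiv M N) : UCEquiv N M := by
  obtain ⟨L, hL, σ, h⟩ := h
  refine ⟨Lᴴ, conjTranspose_mem hL, σ.symm, fun i => ?_⟩
  have hi := h (σ.symm i)
  rw [Equiv.apply_symm_apply] at hi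
  exact hi.conjTranspose_mul_mul hL (conjTranspose_mem hL)

theorem UCEquiv.trans (h : UCEquiv M N) (h' : UCEquiv N P) : UCEquiv M P := by
  obtain ⟨L, hL, σ, h⟩ := h
  obtain ⟨L', hL', τ, h'⟩ := h'
  refine ⟨L' * L, mul_mem hL' hL, τ.trans σ, fun i => ?_⟩
  simpa only [Equiv.trans_apply, conjTranspose_mul, Matrix.mul_assoc]
    using (h' i).trans ((h (τ i)).mul_mul L' L'ᴴ)

theorem UCEquiv.ucClass_eq (h : UCEquiv M N) : UCClass M = UCClass N :=
  Set.ext fun _ => ⟨h.symm.trans, h.trans⟩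

theorem mes_eq_smul_vec (U : Mat d) : mes U = (1 / Real.sqrt d : ℂ) • vec U := by
  have h : maxEnt d = (1 / Real.sqrt d : ℂ) • vec (1 : Mat d) := by
    ext ⟨a, b⟩
    simp [maxEnt, vec, Matrix.one_apply, eq_comm]
  rw [mes, h, mulVec_smul, kronecker_mulVec_vec, Matrix.mul_one, transpose_one, Matrix.mul_one]

theorem kronecker_mulVec_mes (A B U : Mat d) : (A ⊗ₖ B) *ᵥ mes U = mes (B * U * Aᵀ) := by
  rw [mes_eq_smul_vec, mes_eq_smul_vec, mulVec_smul, kronecker_mulVec_vec]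

theorem phaseEq_mes_iff {U V : Mat d} : PhaseEq (mes U) (mes V) ↔ PhaseEq U V := by
  have hd : (1 / Real.sqrt d : ℂ) ≠ 0 := by
    simpa using NeZero.ne d
  refine exists_congr fun c => and_congr_right fun _ => ?_
  rw [mes_eq_smul_vec, mes_eq_smul_vec, smul_comm c, smul_right_inj hd, ← vec_smul, vec_inj]

theorem luEquiv_mes_iff : LUEquiv (fun i => mes (M i)) (fun i => mes (N i)) ↔ UEquiv M N := by
  simp only [LUEquiv, UEquiv, kronecker_mulVec_mes, phaseEq_mes_iff]
  constructor
  · rintro ⟨A, hA, B, hB, σ, h⟩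
    exact ⟨B, hB, Aᵀ, transpose_mem_unitaryGroup_iff.2 hA, σ, h⟩
  · rintro ⟨L, hL, R, hR, σ, h⟩
    exact ⟨Rᵀ, transpose_mem_unitaryGroup_iff.2 hR, L, hL, σ, by simpa only [transpose_transpose]⟩

theorem card_eq_of_mem_uClass [Fintype ι] {S : Finset (ZMod d × ZMod d)} (hS : S ∈ UClass M) :
    S.card = Fintype.card ι := by
  obtain ⟨-, L, -, R, -, σ, -⟩ := hS
  simpa only [Fintype.card_coe] using Fintype.card_congr σ

end Equivalences

section Pauli

variable {d : ℕ} [NeZero d]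

theorem shiftX_pow_apply (k : ℕ) (i j : ZMod d) :
    (shiftX d ^ k) i j = if i = j + k then 1 else 0 := by
  induction k generalizing i j with
  | zero => simp [Matrix.one_apply]
  | succ k ih =>
    rw [pow_succ, Matrix.mul_apply, Finset.sum_eq_single (j + 1)]
    · rw [ih, shiftX, Matrix.of_apply, if_pos rfl, mul_one, Nat.cast_succ, add_right_comm,
        ← add_assoc]
    · intro b _ hb
      simp [shiftX, hb]
    · simp

theorem exp_pow_val (j : ZMod d) :
    Complex.exp (2 * Real.pi * Complex.I / d) ^ j.val = stdAddChar j := by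
  have h := stdAddChar_coe (N := d) (j.val : ℤ)
  rw [Int.cast_natCast, natCast_zmod_val] at h
  rw [← Complex.exp_nat_mul, h]
  congr 1
  push_cast
  ring

theorem gpm_apply (p : ZMod d × ZMod d) (i j : ZMod d) :
    gpm p i j = if i = j + p.1 then stdAddChar (p.2 * j) else 0 := by
  rw [gpm, clockZ, diagonal_pow, mul_diagonal, shiftX_pow_apply, natCast_zmod_val, Pi.pow_apply,
    exp_pow_val, ← AddChar.map_nsmul_eq_pow, nsmul_eq_mul, natCast_zmod_val, ite_mul, one_mul,
    zero_mul]

theorem norm_stdAddChar (j : ZMod d) : ‖(stdAddChar j : ℂ)‖ = 1 := by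
  rw [stdAddChar_apply, Circle.norm_coe]

theorem gpm_zero : gpm (0 : ZMod d × ZMod d) = 1 := by
  ext i j
  simp [gpm_apply, Matrix.one_apply]

theorem gpm_mul (p q : ZMod d × ZMod d) :
    gpm p * gpm q = (stdAddChar (p.2 * q.1) : ℂ) • gpm (p + q) := by
  ext i j
  rw [Matrix.mul_apply, Finset.sum_eq_single (j + q.1)]
  · simp only [gpm_apply, if_true, Matrix.smul_apply, smul_eq_mul, Prod.fst_add, Prod.snd_add,
      add_assoc, add_comm q.1 p.1, ite_mul, zero_mul, mul_ite, mul_zero]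
    rw [← AddChar.map_add_eq_mul, ← AddChar.map_add_eq_mul]
    congr 2
    ring
  · intro b _ hb
    simp [gpm_apply q, hb]
  · simp

theorem gpm_add_phaseEq (p q : ZMod d × ZMod d) : PhaseEq (gpm (p + q)) (gpm p * gpm q) :=
  PhaseEq.symm ⟨_, norm_stdAddChar _, gpm_mul p q⟩

theorem shiftX_mem_unitaryGroup : shiftX d ∈ unitaryGroup (ZMod d) ℂ := by
  rw [mem_unitaryGroup_iff]
  ext i j
  rw [Matrix.mul_apply, Finset.sum_eq_single (j - 1)]
  · simp [shiftX, Matrix.star_apply, Matrix.one_apply]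
  · intro b _ hb
    have hjb : j ≠ b + 1 := fun h => hb (eq_sub_of_add_eq h.symm)
    simp [shiftX, Matrix.star_apply, hjb]
  · simp

theorem clockZ_mem_unitaryGroup : clockZ d ∈ unitaryGroup (ZMod d) ℂ :=
  diagonal_mem_unitaryGroup fun j => by rw [exp_pow_val, norm_stdAddChar]

theorem gpm_mem_unitaryGroup (p : ZMod d × ZMod d) : gpm p ∈ unitaryGroup (ZMod d) ℂ :=
  mul_mem (pow_mem shiftX_mem_unitaryGroup _) (pow_mem clockZ_mem_unitaryGroup _)

theorem gpm_ne_zero (p : ZMod d × ZMod d) : gpm p ≠ 0 := fun h => by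
  simpa [h] using mul_conjTranspose_of_mem (gpm_mem_unitaryGroup p)

theorem eq_of_phaseEq_gpm {p q : ZMod d × ZMod d} (h : PhaseEq (gpm p) (gpm q)) : p = q := by
  obtain ⟨c, -, h⟩ := h
  have h0 := congrFun (congrFun h p.1) 0
  have h1 := congrFun (congrFun h (1 + p.1)) 1
  simp only [gpm_apply, Matrix.smul_apply, smul_eq_mul, zero_add, if_true, mul_zero,
    AddChar.map_zero_eq_one, mul_one] at h0 h1
  have hfst : p.1 = q.1 := by
    by_contra hne
    simp [hne] at h0
  rw [if_pos hfst, mul_one] at h0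
  rw [if_pos (by rw [hfst]), ← h0, one_mul] at h1
  exact Prod.ext hfst (injective_stdAddChar h1)

theorem gpm_sub_phaseEq (p q : ZMod d × ZMod d) :
    PhaseEq (gpm (p - q)) (gpm p * (gpm q)ᴴ) := by
  have h : PhaseEq (gpm p) (1 * gpm (p - q) * gpm q) := by
    simpa only [sub_add_cancel, Matrix.one_mul] using gpm_add_phaseEq (p - q) q
  simpa using h.conjTranspose_mul_mul (one_mem _) (gpm_mem_unitaryGroup q)

/-- The symplectic form on labels, which measures how far two generalized Pauli matrices are from
commuting; see `gpm_mul_comm`. -/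
def symp (p q : ZMod d × ZMod d) : ZMod d := p.2 * q.1 - q.2 * p.1

theorem gpm_mul_comm (p q : ZMod d × ZMod d) :
    gpm p * gpm q = (stdAddChar (symp p q) : ℂ) • (gpm q * gpm p) := by
  rw [gpm_mul, gpm_mul, smul_smul, ← AddChar.map_add_eq_mul, add_comm q p, symp, sub_add_cancel]

end Pauli

section Conj

variable {d : ℕ} [NeZero d] {U : Mat d} {p q p' q' p'' q'' : ZMod d × ZMod d}
  {f g : ZMod d × ZMod d → ZMod d × ZMod d}

/-- Conjugation by `U` maps the generalized Pauli matrix with label `p` to the one with label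
`q`, up to a phase. -/
def ConjTo (U : Mat d) (p q : ZMod d × ZMod d) : Prop := PhaseEq (gpm q) (U * gpm p * Uᴴ)

theorem conj_mul_conj (hU : U ∈ unitaryGroup (ZMod d) ℂ) (A B : Mat d) :
    (U * A * Uᴴ) * (U * B * Uᴴ) = U * (A * B) * Uᴴ := by
  calc (U * A * Uᴴ) * (U * B * Uᴴ) = U * A * (Uᴴ * U) * B * Uᴴ := by simp only [Matrix.mul_assoc]
    _ = U * (A * B) * Uᴴ := by
      rw [conjTranspose_mul_of_mem hU, Matrix.mul_one, Matrix.mul_assoc U]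

theorem ConjTo.add (hU : U ∈ unitaryGroup (ZMod d) ℂ) (h : ConjTo U p q) (h' : ConjTo U p' q') :
    ConjTo U (p + p') (q + q') := by
  have hmul := h.mul h'
  rw [conj_mul_conj hU] at hmul
  exact ((gpm_add_phaseEq q q').trans hmul).trans ((gpm_add_phaseEq p p').symm.mul_mul U Uᴴ)

theorem ConjTo.right_unique (h : ConjTo U p q) (h' : ConjTo U p q') : q = q' :=
  eq_of_phaseEq_gpm (h.trans (PhaseEq.symm h'))

theorem ConjTo.symm (hU : U ∈ unitaryGroup (ZMod d) ℂ) (h : ConjTo U p q) : ConjTo Uᴴ q p :=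
  PhaseEq.conjTranspose_mul_mul hU (conjTranspose_mem hU) h

theorem ConjTo.eq_iff (hU : U ∈ unitaryGroup (ZMod d) ℂ) (h : ConjTo U p q)
    (h' : ConjTo U p' q') : p = p' ↔ q = q' :=
  ⟨fun hp => h.right_unique (hp ▸ h'), fun hq => (h.symm hU).right_unique (hq ▸ h'.symm hU)⟩

theorem ConjTo.add_eq_iff (hU : U ∈ unitaryGroup (ZMod d) ℂ) (h : ConjTo U p q)
    (h' : ConjTo U p' q') (h'' : ConjTo U p'' q'') : p + p' = p'' ↔ q + q' = q'' :=
  (h.add hU h').eq_iff hU h''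

theorem ConjTo.symp_eq (hU : U ∈ unitaryGroup (ZMod d) ℂ) (h : ConjTo U p q)
    (h' : ConjTo U p' q') : symp p p' = symp q q' := by
  obtain ⟨x, -, h⟩ := h
  obtain ⟨y, -, h'⟩ := h'
  have hcomm : gpm q * gpm q' = (stdAddChar (symp p p') : ℂ) • (gpm q' * gpm q) := by
    rw [h, h', smul_mul_smul_comm, smul_mul_smul_comm, conj_mul_conj hU, conj_mul_conj hU,
      gpm_mul_comm p p', Matrix.mul_smul, Matrix.smul_mul, smul_comm, mul_comm x y]
  have hne : gpm q' * gpm q ≠ 0 := fun h0 => gpm_ne_zero (q' + q) <| by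
    obtain ⟨c, -, hc⟩ := gpm_add_phaseEq q' q
    rw [hc, h0, smul_zero]
  rw [gpm_mul_comm q q'] at hcomm
  exact (injective_stdAddChar (smul_left_injective ℂ hne hcomm)).symm

/-- A map of labels that is induced by conjugation with a unitary matrix. -/
def IsClifford (f : ZMod d × ZMod d → ZMod d × ZMod d) : Prop :=
  ∃ U ∈ unitaryGroup (ZMod d) ℂ, ∀ p, ConjTo U p (f p)

theorem IsClifford.id : IsClifford (d := d) id :=
  ⟨1, one_mem _, fun p => by simpa [ConjTo] using PhaseEq.refl (gpm p)⟩

theorem IsClifford.comp (hf : IsClifford f) (hg : IsClifford g) : IsClifford (f ∘ g) := by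
  obtain ⟨U, hU, hf⟩ := hf
  obtain ⟨V, hV, hg⟩ := hg
  refine ⟨U * V, mul_mem hU hV, fun p => ?_⟩
  have h := (hf (g p)).trans ((hg p).mul_mul U Uᴴ)
  simpa only [ConjTo, Function.comp, conjTranspose_mul, Matrix.mul_assoc] using h

theorem IsClifford.iterate (hf : IsClifford f) (n : ℕ) : IsClifford f^[n] := by
  induction n with
  | zero => exact IsClifford.id
  | succ n ih => exact ih.comp hf

theorem IsClifford.injective (hf : IsClifford f) : Function.Injective f := by
  obtain ⟨U, hU, hf⟩ := hf
  exact fun p q hpq => ((hf p).eq_iff hU (hf q)).2 hpq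

theorem IsClifford.ucEquiv {ι : Type*} (hf : IsClifford f) (p : ι → ZMod d × ZMod d) :
    UCEquiv (gpm ∘ p) (gpm ∘ f ∘ p) := by
  obtain ⟨U, hU, hf⟩ := hf
  exact ⟨U, hU, Equiv.refl ι, fun i => hf (p i)⟩

theorem conjTo_of_mul_eq (hU : U ∈ unitaryGroup (ZMod d) ℂ)
    (h : PhaseEq (gpm q * U) (U * gpm p)) : ConjTo U p q := by
  have h' := h.mul (PhaseEq.refl Uᴴ)
  rwa [Matrix.mul_assoc, mul_conjTranspose_of_mem hU, Matrix.mul_one] at h'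

end Conj

section Clifford

variable {d : ℕ} [NeZero d]

variable (d) in
/-- The matrix of the discrete Fourier transform, normalized to be unitary. -/
noncomputable def dftMatrix : Mat d :=
  Matrix.of fun j k => (1 / Real.sqrt d : ℂ) * stdAddChar (j * k)

theorem dftMatrix_mul_star_apply (i j k : ZMod d) :
    dftMatrix d i k * star (dftMatrix d) k j = (1 / d : ℂ) * stdAddChar (k * (i - j)) := by
  have hsqrt : (1 / Real.sqrt d : ℂ) * star (1 / Real.sqrt d : ℂ) = 1 / d := by
    rw [star_div₀, star_one, Complex.star_def, Complex.conj_ofReal, div_mul_div_comm, one_mul,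
      ← Complex.ofReal_mul, Real.mul_self_sqrt (Nat.cast_nonneg d), Complex.ofReal_natCast]
  have hchar : star (stdAddChar (j * k) : ℂ) = stdAddChar (-(j * k)) :=
    (AddChar.map_neg_eq_conj _ _).symm
  simp only [dftMatrix, Matrix.star_apply, Matrix.of_apply]
  rw [star_mul', hchar, mul_mul_mul_comm, hsqrt, ← AddChar.map_add_eq_mul]
  congr 2
  ring

theorem dftMatrix_mem_unitaryGroup : dftMatrix d ∈ unitaryGroup (ZMod d) ℂ := by
  have hd : (d : ℂ) ≠ 0 := Nat.cast_ne_zero.2 (NeZero.ne d)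
  rw [mem_unitaryGroup_iff]
  ext i j
  rw [Matrix.mul_apply, Finset.sum_congr rfl fun k _ => dftMatrix_mul_star_apply i j k,
    ← Finset.mul_sum, AddChar.sum_mulShift _ (isPrimitive_stdAddChar d), ZMod.card,
    Matrix.one_apply]
  simp only [sub_eq_zero]
  split_ifs
  · rw [one_div_mul_cancel hd]
  · rw [Nat.cast_zero, mul_zero]

/-- The label map of conjugation by the discrete Fourier transform. -/
def fourierMap (p : ZMod d × ZMod d) : ZMod d × ZMod d := (-p.2, p.1)

theorem isClifford_fourierMap : IsClifford (fourierMap (d := d)) := by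
  refine ⟨dftMatrix d, dftMatrix_mem_unitaryGroup, fun p =>
    conjTo_of_mul_eq dftMatrix_mem_unitaryGroup ⟨stdAddChar (p.1 * p.2), norm_stdAddChar _, ?_⟩⟩
  ext k j
  rw [Matrix.smul_apply, Matrix.mul_apply, Matrix.mul_apply, Finset.sum_eq_single (k + p.2),
    Finset.sum_eq_single (j + p.1)]
  · simp only [fourierMap, gpm_apply, dftMatrix, Matrix.of_apply, add_neg_cancel_right, if_true,
      smul_eq_mul]
    rw [mul_left_comm, ← AddChar.map_add_eq_mul, mul_assoc, mul_left_comm,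
      ← AddChar.map_add_eq_mul, ← AddChar.map_add_eq_mul]
    congr 2
    ring
  · intro b _ hb
    simp [gpm_apply, hb]
  · simp
  · intro b _ hb
    have hkb : k ≠ b + -p.2 := fun h => hb (eq_add_of_add_neg_eq h.symm)
    simp [fourierMap, gpm_apply, hkb]
  · simp

/-- The phase `exp (π i j (j + d) / d)`. The shift by `d` makes it depend only on `j` modulo `d`,
for even and for odd `d`. -/
noncomputable def quadraticPhase (d j : ℕ) : ℂ :=
  Complex.exp (Real.pi * Complex.I * (j * (j + d)) / d)

theorem norm_quadraticPhase (d j : ℕ) : ‖quadraticPhase d j‖ = 1 := by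
  have h : (Real.pi * Complex.I * (j * (j + d)) / d : ℂ)
      = ((Real.pi * (j * (j + d)) / d : ℝ) : ℂ) * Complex.I := by
    push_cast
    ring
  rw [quadraticPhase, h, Complex.norm_exp_ofReal_mul_I]

theorem quadraticPhase_periodic : Function.Periodic (quadraticPhase d) d := fun j => by
  have hd : (d : ℂ) ≠ 0 := Nat.cast_ne_zero.2 (NeZero.ne d)
  have h : (Real.pi * Complex.I * ((j + d : ℕ) * ((j + d : ℕ) + d)) / d : ℂ)
      = Real.pi * Complex.I * (j * (j + d)) / d + (j + d : ℕ) * (2 * Real.pi * Complex.I) := by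
    push_cast
    field_simp
    ring
  rw [quadraticPhase, h, Complex.exp_periodic.nat_mul, quadraticPhase]

theorem quadraticPhase_add (j m : ℕ) :
    quadraticPhase d (j + m) = quadraticPhase d j * quadraticPhase d m
      * stdAddChar ((m * j : ℕ) : ZMod d) := by
  have hchar := stdAddChar_coe (N := d) ((m * j : ℕ) : ℤ)
  rw [Int.cast_natCast] at hchar
  rw [hchar, quadraticPhase, quadraticPhase, quadraticPhase, ← Complex.exp_add, ← Complex.exp_add]
  congr 1
  push_cast
  ring

theorem quadraticPhase_val_add (j m : ZMod d) :
    quadraticPhase d (j + m).val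
      = quadraticPhase d j.val * quadraticPhase d m.val * stdAddChar (m * j) := by
  rw [val_add, quadraticPhase_periodic.map_mod_nat, quadraticPhase_add, Nat.cast_mul,
    natCast_zmod_val, natCast_zmod_val]

/-- The label map of conjugation by the diagonal matrix with entries `quadraticPhase d j`. -/
def shearMap (p : ZMod d × ZMod d) : ZMod d × ZMod d := (p.1, p.2 + p.1)

theorem isClifford_shearMap : IsClifford (shearMap (d := d)) := by
  have hU := diagonal_mem_unitaryGroup fun j : ZMod d => norm_quadraticPhase d j.val
  refine ⟨_, hU, fun p => conjTo_of_mul_eq hU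
    (PhaseEq.symm ⟨quadraticPhase d p.1.val, norm_quadraticPhase d _, ?_⟩)⟩
  ext i j
  rw [diagonal_mul, Matrix.smul_apply, mul_diagonal]
  simp only [shearMap, gpm_apply, smul_eq_mul]
  split_ifs with h
  · rw [h, quadraticPhase_val_add, add_mul, AddChar.map_add_eq_mul]
    ring
  · simp

end Clifford

section Labels

variable {d : ℕ} {ι : Type*}

/-- The labels of `rightDiv (gpm ∘ p) i`. -/
def translate (p : ι → ZMod d × ZMod d) (i : ι) : ι → ZMod d × ZMod d := fun j => p j - p i

theorem translate_injective {p : ι → ZMod d × ZMod d} (hp : Function.Injective p) (i : ι) :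
    Function.Injective (translate p i) :=
  sub_left_injective.comp hp

variable [NeZero d]

theorem zero_mem_of_mem_ucClass {M : ι → Mat d} {i : ι} (hi : M i = 1)
    {S : Finset (ZMod d × ZMod d)} (hS : S ∈ UCClass M) : (0, 0) ∈ S := by
  obtain ⟨L, hL, σ, h⟩ := hS
  have h0 := h (σ.symm i)
  rw [Equiv.apply_symm_apply, hi, Matrix.mul_one, mul_conjTranspose_of_mem hL, ← gpm_zero] at h0
  have hzero : (σ.symm i : ZMod d × ZMod d) = (0, 0) := eq_of_phaseEq_gpm h0
  exact hzero ▸ (σ.symm i).2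

theorem uClass_eq_iUnion {M : ι → Mat d} (hM : ∀ i, M i ∈ unitaryGroup (ZMod d) ℂ) :
    UClass M = ⋃ i, UCClass (rightDiv M i) := by
  ext S
  rw [Set.mem_iUnion]
  constructor
  · rintro ⟨h0, L, hL, R, -, σ, h⟩
    set i := σ ⟨_, h0⟩
    have hone : PhaseEq (1 : Mat d) (L * M i * R * 1) := by
      rw [Matrix.mul_one, ← gpm_zero]
      exact h ⟨_, h0⟩
    have hRi : PhaseEq R ((M i)ᴴ * Lᴴ) := by
      simpa using hone.conjTranspose_mul_mul (mul_mem hL (hM i)) (one_mem _)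
    refine ⟨i, L, hL, σ, fun j => (h j).trans ?_⟩
    simpa only [rightDiv, Matrix.mul_assoc] using (PhaseEq.refl (L * M (σ j))).mul hRi
  · rintro ⟨i, h⟩
    refine ⟨zero_mem_of_mem_ucClass (M := rightDiv M i) (mul_conjTranspose_of_mem (hM i)) h, ?_⟩
    obtain ⟨L, hL, σ, h⟩ := h
    refine ⟨L, hL, (M i)ᴴ * Lᴴ, mul_mem (conjTranspose_mem (hM i)) (conjTranspose_mem hL), σ,
      fun j => ?_⟩
    simpa only [rightDiv, Matrix.mul_assoc] using h j

theorem ucEquiv_gpmSet {p : ι → ZMod d × ZMod d} (hp : Function.Injective p)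
    {S : Finset (ZMod d × ZMod d)} (hS : (S : Set (ZMod d × ZMod d)) = Set.range p) :
    UCEquiv (gpm ∘ p) (gpmSet S) := by
  let σ : S ≃ ι := (Equiv.setCongr hS).trans (Equiv.ofInjective p hp).symm
  refine UCEquiv.of_phaseEq σ fun x => ?_
  have hσ : p (σ x) = x := Equiv.apply_ofInjective_symm hp _
  rw [gpmSet, Function.comp_apply, hσ]
  exact PhaseEq.refl _

theorem uEquiv_gpm_sub (p : ι → ZMod d × ZMod d) (a : ZMod d × ZMod d) :
    UEquiv (gpm ∘ p) (gpm ∘ fun j => p j - a) := by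
  refine ⟨1, one_mem _, (gpm a)ᴴ, conjTranspose_mem (gpm_mem_unitaryGroup a), Equiv.refl ι,
    fun j => ?_⟩
  simpa using gpm_sub_phaseEq (p j) a

theorem uEquiv_image_sub (S : Finset (ZMod d × ZMod d)) (a : ZMod d × ZMod d) :
    UEquiv (gpmSet S) (gpmSet (S.image (· - a))) := by
  have hinj : Function.Injective fun x : S => (x : ZMod d × ZMod d) - a :=
    sub_left_injective.comp Subtype.val_injective
  exact (uEquiv_gpm_sub Subtype.val a).trans (ucEquiv_gpmSet hinj (by ext; simp)).uEquiv

theorem ucEquiv_rightDiv (p : ι → ZMod d × ZMod d) (i : ι) :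
    UCEquiv (rightDiv (gpm ∘ p) i) (gpm ∘ translate p i) :=
  UCEquiv.of_phaseEq (Equiv.refl ι) fun j => gpm_sub_phaseEq (p j) (p i)

end Labels

section Profile

variable {d : ℕ} {ι κ : Type*} [Fintype ι] [Fintype κ]

open Finset in
/-- An invariant of families of labels under UC-equivalence of the corresponding matrices. It
records for each member `p i` in how many ways it arises by doubling a member and by adding two
members, and its total symplectic form with all members. -/
def profile (p : ι → ZMod d × ZMod d) : Multiset (ℕ × ℕ × ZMod d) :=
  univ.val.map fun i =>
    (#{j | p j + p j = p i}, #{x : ι × ι | p x.1 + p x.2 = p i}, ∑ j, symp (p i) (p j))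

theorem profile_comp_equiv (σ : κ ≃ ι) (p : ι → ZMod d × ZMod d) :
    profile (p ∘ σ) = profile p := by
  simp only [profile, Finset.card_filter, Function.comp_apply]
  rw [← Multiset.map_univ_val_equiv σ, Multiset.map_map]
  refine Multiset.map_congr rfl fun i _ => ?_
  refine Prod.ext ?_ (Prod.ext ?_ ?_)
  · exact σ.sum_comp fun j => if p j + p j = p (σ i) then 1 else 0
  · exact (σ.prodCongr σ).sum_comp fun x => if p x.1 + p x.2 = p (σ i) then 1 else 0
  · exact σ.sum_comp fun j => symp (p (σ i)) (p j)

theorem UCEquiv.profile_eq [NeZero d] {p : ι → ZMod d × ZMod d} {q : κ → ZMod d × ZMod d}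
    (h : UCEquiv (gpm ∘ p) (gpm ∘ q)) : profile p = profile q := by
  obtain ⟨L, hL, σ, h⟩ := h
  have hconj : ∀ i, ConjTo L ((p ∘ σ) i) (q i) := h
  rw [← profile_comp_equiv σ p]
  refine Multiset.map_congr rfl fun i _ => ?_
  simp only [(hconj _).add_eq_iff hL (hconj _) (hconj i), (hconj i).symp_eq hL (hconj _)]

end Profile

section CliffordWord

variable {d : ℕ} [NeZero d]

/-- A normal form for Clifford maps; for `d = 4` these words cover all of `SL(2, ℤ/4)`. -/
def cliffordWord (a b c : ℕ) : ZMod d × ZMod d → ZMod d × ZMod d :=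
  fourierMap^[a] ∘ shearMap^[b] ∘ fourierMap ∘ shearMap^[c]

theorem isClifford_cliffordWord (a b c : ℕ) : IsClifford (cliffordWord (d := d) a b c) :=
  (isClifford_fourierMap.iterate a).comp <| (isClifford_shearMap.iterate b).comp <|
    isClifford_fourierMap.comp (isClifford_shearMap.iterate c)

end CliffordWord

section Listed

/-- The position of a label in the lexicographic order. -/
def labelIndex (p : Label) : ℕ := 4 * p.1.val + p.2.val

theorem labelIndex_injective : Function.Injective labelIndex := by
  decide

/-- The set of indices of the labels in `S`, as a binary number. Comparing these numbers makes the
checks on the listed sets fast enough for the kernel. -/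
def bitmask (S : Finset Label) : ℕ := ∑ p ∈ S, 2 ^ labelIndex p

theorem bitmask_image {ι : Type*} [Fintype ι] {p : ι → Label} (hp : Function.Injective p) :
    bitmask (Finset.univ.image p) = ∑ j, 2 ^ labelIndex (p j) :=
  Finset.sum_image hp.injOn

theorem bitmask_injective : Function.Injective bitmask := fun S T h => by
  have hgeom : ∀ S, bitmask S = ∑ n ∈ S.image labelIndex, 2 ^ n := fun S =>
    (Finset.sum_image labelIndex_injective.injOn).symm
  rw [hgeom, hgeom] at h
  exact Finset.image_injective labelIndex_injective (Finset.geomSum_injective le_rfl h)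

theorem rep_injective (k : Fin 10) : Function.Injective (rep k) := by
  decide +revert

set_option maxRecDepth 10000 in
theorem exists_cliffordWord_of_mem_ucTable : ∀ k i, ∀ n ∈ (ucTable k i).map bitmask,
    ∃ a b c : Fin 4, n = ∑ j, 2 ^ labelIndex (cliffordWord a b c (translate (rep k) i j)) := by
  decide +kernel

set_option maxRecDepth 10000 in
theorem eq_and_ucTable_eq_of_profile_eq : ∀ k l i j,
    profile (translate (rep k) i) = profile (translate (rep l) j) →
      k = l ∧ ucTable k i = ucTable l j := by
  decide +kernel

set_option maxRecDepth 10000 in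
theorem nodup_bitmask_uTable : ∀ k, ((uTable k).map bitmask).Nodup := by
  decide +kernel

theorem uTable_nodup (k : Fin 10) : (uTable k).Nodup :=
  (nodup_bitmask_uTable k).of_map bitmask

theorem ucTable_sublist_uTable (k : Fin 10) (i : Fin 4) : (ucTable k i).Sublist (uTable k) := by
  fin_cases k <;> fin_cases i <;>
    simp (maxDischargeDepth := 3) [ucTable, uTable, List.sublist_append_of_sublist_right]

theorem ucTable_nodup (k : Fin 10) (i : Fin 4) : (ucTable k i).Nodup :=
  (uTable_nodup k).sublist (ucTable_sublist_uTable k i)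

theorem length_uTable : ∀ k, (uTable k).length = classSize k := by
  decide +kernel

theorem length_ucTable : ∀ k i, (ucTable k i).length = ucSize k i := by
  decide +kernel

theorem mem_uTable_iff {k : Fin 10} {S : Finset Label} :
    S ∈ uTable k ↔ ∃ i, S ∈ ucTable k i := by
  refine ⟨?_, fun ⟨i, hi⟩ => (ucTable_sublist_uTable k i).subset hi⟩
  fin_cases k <;> simp +contextual [uTable, ucTable, Fin.exists_fin_succ, or_imp]

end Listed

section Classification

theorem repGPM_mem_unitaryGroup (k : Fin 10) (j : Fin 4) :
    repGPM k j ∈ unitaryGroup (ZMod 4) ℂ :=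
  gpm_mem_unitaryGroup _

theorem ucClass_rightDiv_repGPM (k : Fin 10) (i : Fin 4) :
    UCClass (rightDiv (repGPM k) i) = UCClass (gpm ∘ translate (rep k) i) :=
  (ucEquiv_rightDiv (rep k) i).ucClass_eq

theorem mem_ucClass_of_mem_ucTable {k : Fin 10} {i : Fin 4} {S : Finset Label}
    (hS : S ∈ ucTable k i) : S ∈ UCClass (rightDiv (repGPM k) i) := by
  obtain ⟨a, b, c, habc⟩ :=
    exists_cliffordWord_of_mem_ucTable k i (bitmask S) (List.mem_map_of_mem hS)
  have hword : IsClifford (cliffordWord (d := 4) a b c) := isClifford_cliffordWord a b c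
  have hinj := hword.injective.comp (translate_injective (rep_injective k) i)
  obtain rfl := bitmask_injective (habc.trans (bitmask_image hinj).symm)
  rw [ucClass_rightDiv_repGPM]
  exact (hword.ucEquiv _).trans (ucEquiv_gpmSet hinj Fintype.coe_image_univ)

theorem eq_and_ucTable_eq_of_mem {k l : Fin 10} {i j : Fin 4} {S : Finset Label}
    (hk : S ∈ UCClass (rightDiv (repGPM k) i)) (hl : S ∈ UCClass (rightDiv (repGPM l) j)) :
    k = l ∧ ucTable k i = ucTable l j := by
  rw [ucClass_rightDiv_repGPM] at hk hl
  exact eq_and_ucTable_eq_of_profile_eq k l i j (UCEquiv.profile_eq (hk.trans hl.symm))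

theorem mem_uClass_of_mem_uTable {k : Fin 10} {S : Finset Label} (hS : S ∈ uTable k) :
    S ∈ UClass (repGPM k) := by
  rw [uClass_eq_iUnion (repGPM_mem_unitaryGroup k), Set.mem_iUnion]
  exact (mem_uTable_iff.1 hS).imp fun _ => mem_ucClass_of_mem_ucTable

theorem eq_of_mem_uClass {k l : Fin 10} {S : Finset Label} (hk : S ∈ UClass (repGPM k))
    (hl : S ∈ UClass (repGPM l)) : k = l := by
  rw [uClass_eq_iUnion (repGPM_mem_unitaryGroup _), Set.mem_iUnion] at hk hl
  obtain ⟨⟨i, hi⟩, ⟨j, hj⟩⟩ := hk, hl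
  exact (eq_and_ucTable_eq_of_mem hi hj).1

theorem image_rep_mem_uClass (k : Fin 10) : Finset.univ.image (rep k) ∈ UClass (repGPM k) := by
  have hzero : ∀ k, (0, 0) ∈ Finset.univ.image (rep k) := by decide
  exact ⟨hzero k, (ucEquiv_gpmSet (rep_injective k) Fintype.coe_image_univ).uEquiv⟩

theorem eq_of_uEquiv_repGPM {k l : Fin 10} (h : UEquiv (repGPM k) (repGPM l)) : k = l :=
  have hl := image_rep_mem_uClass l
  eq_of_mem_uClass ⟨hl.1, h.trans hl.2⟩ hl

/-- The standard sets of four labels. -/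
def standardSets : Finset (Finset Label) :=
  {S ∈ Finset.univ.powersetCard 4 | {0} ⊆ S}

theorem mem_standardSets {S : Finset Label} : S ∈ standardSets ↔ S.card = 4 ∧ 0 ∈ S := by
  simp [standardSets]

theorem card_standardSets : standardSets.card = 455 := by
  rw [standardSets, Finset.card_filter_powersetCard_subset _ _ _ (Finset.subset_univ _) (by simp)]
  decide

theorem mem_standardSets_of_mem_uClass {k : Fin 10} {S : Finset Label}
    (hS : S ∈ UClass (repGPM k)) : S ∈ standardSets :=
  mem_standardSets.2 ⟨card_eq_of_mem_uClass hS, hS.1⟩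

theorem biUnion_uTable : (Finset.univ.biUnion fun k => (uTable k).toFinset) = standardSets := by
  refine Finset.eq_of_subset_of_card_le ?_ ?_
  · refine Finset.biUnion_subset.2 fun k _ S hS => ?_
    exact mem_standardSets_of_mem_uClass (mem_uClass_of_mem_uTable (List.mem_toFinset.1 hS))
  · rw [card_standardSets, Finset.card_biUnion]
    · simp only [List.toFinset_card_of_nodup (uTable_nodup _), length_uTable]
      decide
    · refine fun k _ l _ hkl => Finset.disjoint_left.2 fun S hk hl => hkl ?_
      exact eq_of_mem_uClass (mem_uClass_of_mem_uTable (List.mem_toFinset.1 hk))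
        (mem_uClass_of_mem_uTable (List.mem_toFinset.1 hl))

theorem exists_mem_uTable {S : Finset Label} (hS : S ∈ standardSets) : ∃ k, S ∈ uTable k := by
  simpa [← biUnion_uTable] using hS

theorem uClass_eq (k : Fin 10) : UClass (repGPM k) = {S | S ∈ uTable k} := by
  refine Set.Subset.antisymm (fun S hS => ?_) fun S => mem_uClass_of_mem_uTable
  obtain ⟨l, hl⟩ := exists_mem_uTable (mem_standardSets_of_mem_uClass hS)
  obtain rfl := eq_of_mem_uClass hS (mem_uClass_of_mem_uTable hl)
  exact hl

theorem ucClass_rightDiv_eq (k : Fin 10) (i : Fin 4) :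
    UCClass (rightDiv (repGPM k) i) = {S | S ∈ ucTable k i} := by
  refine Set.Subset.antisymm (fun S hS => ?_) fun S => mem_ucClass_of_mem_ucTable
  have hSk : S ∈ UClass (repGPM k) := by
    rw [uClass_eq_iUnion (repGPM_mem_unitaryGroup k)]
    exact Set.mem_iUnion_of_mem i hS
  rw [uClass_eq, Set.mem_ofPred_eq, mem_uTable_iff] at hSk
  obtain ⟨j, hj⟩ := hSk
  rw [Set.mem_ofPred_eq, (eq_and_ucTable_eq_of_mem hS (mem_ucClass_of_mem_ucTable hj)).2]
  exact hj

theorem exists_uEquiv_gpmSet {S : Finset Label} (hS : S.card = 4) :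
    ∃ k, UEquiv (repGPM k) (gpmSet S) := by
  obtain ⟨p, hp⟩ : S.Nonempty := Finset.card_pos.1 (by omega)
  have hstd : S.image (· - p) ∈ standardSets := mem_standardSets.2
    ⟨by rw [Finset.card_image_of_injective _ sub_left_injective, hS],
      Finset.mem_image.2 ⟨p, hp, sub_self p⟩⟩
  obtain ⟨k, hk⟩ := exists_mem_uTable hstd
  exact ⟨k, (mem_uClass_of_mem_uTable hk).2.trans (uEquiv_image_sub S p).symm⟩

theorem luEquiv_repGBS_iff {k l : Fin 10} :
    LUEquiv (repGBS k) (repGBS l) ↔ UEquiv (repGPM k) (repGPM l) :=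
  luEquiv_mes_iff

theorem luEquiv_gbsSet_iff {k : Fin 10} {S : Finset Label} :
    LUEquiv (repGBS k) (gbsSet S) ↔ UEquiv (repGPM k) (gpmSet S) :=
  luEquiv_mes_iff

theorem ncard_setOf_mem {α : Type*} {l : List α} (hl : l.Nodup) :
    {x | x ∈ l}.ncard = l.length := by
  classical
  rw [← List.coe_toFinset, Set.ncard_coe_finset, List.toFinset_card_of_nodup hl]

end Classification

end GBS

theorem mainTheorem3 :
    -- the explicit lists of the UC-equivalence classes and their sizes
    (∀ (k : Fin 10) (i : Fin 4),
      GBS.UCClass (GBS.rightDiv (GBS.repGPM k) i) = {N | N ∈ GBS.ucTable k i} ∧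
      (GBS.UCClass (GBS.rightDiv (GBS.repGPM k) i)).ncard = GBS.ucSize k i) ∧
    -- the explicit lists of the U-equivalence classes of standard sets and their sizes
    (∀ k : Fin 10,
      GBS.UClass (GBS.repGPM k) = ⋃ i : Fin 4, GBS.UCClass (GBS.rightDiv (GBS.repGPM k) i) ∧
      GBS.UClass (GBS.repGPM k) = {N | N ∈ GBS.uTable k} ∧
      (GBS.UClass (GBS.repGPM k)).ncard = GBS.classSize k) ∧
    -- the representatives are pairwise inequivalent
    (∀ k l : Fin 10, k ≠ l →
      ¬ GBS.UEquiv (GBS.repGPM k) (GBS.repGPM l) ∧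
      ¬ GBS.LUEquiv (GBS.repGBS k) (GBS.repGBS l)) ∧
    -- every set of four generalized Bell states belongs to exactly one of the ten classes
    (∀ S : Finset (ZMod 4 × ZMod 4), S.card = 4 →
      ∃! k : Fin 10, GBS.LUEquiv (GBS.repGBS k) (GBS.gbsSet S)) := by
  refine ⟨fun k i => ⟨GBS.ucClass_rightDiv_eq k i, ?_⟩,
    fun k => ⟨GBS.uClass_eq_iUnion (GBS.repGPM_mem_unitaryGroup k), GBS.uClass_eq k, ?_⟩,
    fun k l hkl => ⟨fun h => hkl (GBS.eq_of_uEquiv_repGPM h),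
      fun h => hkl (GBS.eq_of_uEquiv_repGPM (GBS.luEquiv_repGBS_iff.1 h))⟩, fun S hS => ?_⟩
  · rw [GBS.ucClass_rightDiv_eq, GBS.ncard_setOf_mem (GBS.ucTable_nodup k i), GBS.length_ucTable]
  · rw [GBS.uClass_eq, GBS.ncard_setOf_mem (GBS.uTable_nodup k), GBS.length_uTable]
  · obtain ⟨k, hk⟩ := GBS.exists_uEquiv_gpmSet hS
    refine ⟨k, GBS.luEquiv_gbsSet_iff.2 hk, fun l hl => ?_⟩
    exact GBS.eq_of_uEquiv_repGPM ((GBS.luEquiv_gbsSet_iff.1 hl).trans hk.symm)
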